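/- Let $c$, $e$ and $m$ be integers with $m>1$, and let $d$ be a rational number such that $dm^2$ and $dcm/e$ are positive integers (so that $c,d,e\neq 0$), $c+dcm/e>0$ and $e+dm^2>0$. Let $$a=\frac{e-\sqrt{e^2+4e/c}}{2},\qquad b=\frac{e+\sqrt{e^2+4e/c}}{2},$$ and write $(z;q)_0=1$ and $(z;q)_n=\prod_{k=0}^{n-1}(1-zq^k)$ for $n\ge 1$. Then the infinite continued fraction $$\left[0;\overline{c+\tfrac{dc}{e}m^{2n-1},\ e+dm^{2n}}\right]_{n=1}^{\infty}=\left[0;\,c+\tfrac{dc}{e}m,\ e+dm^2,\ c+\tfrac{dc}{e}m^3,\ e+dm^4,\ \dots\right]$$ converges, the expression below is well defined (the two series converge and no denominator vanishes), and $$\left[0;\overline{c+\tfrac{dc}{e}m^{2n-1},\ e+dm^{2n}}\right]_{n=1}^{\infty}=\frac{e/c}{md+a}\cdot\frac{\displaystyle\sum_{n=0}^{\infty}\frac{(b/d)^n\,m^{-n(n+3)/2}}{(1/m;1/m)_n\,(-a/(dm^2);1/m)_n}}{\displaystyle\sum_{n=0}^{\infty}\frac{(b/d)^n\,m^{-n(n+1)/2}}{(1/m;1/m)_n\,(-a/(dm);1/m)_n}}.$$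 -/

import Mathlib

open Filter Topology

noncomputable section

/-- The finite `q`-product `(z; q)_n = ∏_{k=0}^{n-1} (1 - z q^k)`. -/
def qProd (z q : ℝ) (n : ℕ) : ℝ := ∏ k ∈ Finset.range n, (1 - z * q ^ k)

/-- The infinite continued fraction `[a₀; a 0, a 1, a 2, …]`
with all partial numerators equal to `1`. -/
def infiniteCF (a₀ : ℝ) (a : ℕ → ℝ) : GenContFract ℝ where
  h := a₀
  s := Stream'.Seq.ofStream fun i => ⟨1, a i⟩

/-- The sequence `f 1, g 1, f 2, g 2, f 3, g 3, …`. -/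
def interlace (f g : ℕ → ℝ) : ℕ → ℝ :=
  fun i => if Even i then f (i / 2 + 1) else g (i / 2 + 1)

end

/-! With `q = 1/m`, let `G(u)` be the sum of `qTerm a b q u`. A contiguous relation links `G(uq)`,
`G(u)` and `G(u/q)`. At `u = d m^(j+1)`, after division by a finite product, it says that `X_j =
qSol a b d m j` satisfies `X_j = (e + d m^(j+1)) X_(j+1) + (e/c) X_(j+2)`, since `a + b = e` and
`-ab = e/c`. Rescaling by powers of `e/c` turns this into the recurrence of the continued fraction.

A positive solution of that recurrence decreases to `0`, so it is the minimal one and the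
convergents tend to `Y 1 / Y 0`. Up to a global sign `X_j` is positive: this is clear for large `j`,
and the recurrence carries it backward. Integrality keeps every denominator away from zero. -/

open Finset in
theorem qProd_succ (z q : ℝ) (n : ℕ) : qProd z q (n + 1) = qProd z q n * (1 - z * q ^ n) :=
  prod_range_succ _ _

open Finset in
theorem qProd_succ' (z q : ℝ) (n : ℕ) : qProd z q (n + 1) = (1 - z) * qProd (z * q) q n := by
  rw [qProd, prod_range_succ', mul_comm]
  simp only [qProd, pow_zero, mul_one]
  congr 1
  exact prod_congr rfl fun k _ => by ring

theorem qProd_ne_zero {z q : ℝ} (h : ∀ k, 1 - z * q ^ k ≠ 0) (n : ℕ) : qProd z q n ≠ 0 :=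
  Finset.prod_ne_zero_iff.2 fun k _ => h k

theorem qProd_pos {z q : ℝ} (h : ∀ k, 0 < 1 - z * q ^ k) (n : ℕ) : 0 < qProd z q n :=
  Finset.prod_pos fun k _ => h k

theorem one_sub_mul_pow_pos {q : ℝ} (h0 : 0 < q) (h1 : q < 1) (k : ℕ) : 0 < 1 - q * q ^ k := by
  rw [← pow_succ', sub_pos]
  exact pow_lt_one₀ h0.le h1 k.succ_ne_zero

/-! ### The q-series and its contiguous relation -/

/-- The general term of the `q`-series `∑ (b/u)ⁿ q^{n(n+1)/2} / ((q;q)_n (-aq/u;q)_n)`. -/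
noncomputable def qTerm (a b q u : ℝ) (n : ℕ) : ℝ :=
  ((b / u) ^ n * q ^ (n * (n + 1) / 2)) / (qProd q q n * qProd (-a * q / u) q n)

theorem qTerm_zero (a b q u : ℝ) : qTerm a b q u 0 = 1 := by simp [qTerm, qProd]

theorem succ_mul_add_two_div_two (n : ℕ) :
    (n + 1) * (n + 1 + 1) / 2 = n * (n + 1) / 2 + (n + 1) := by
  rw [show (n + 1) * (n + 1 + 1) = n * (n + 1) + (n + 1) * 2 by ring,
    Nat.add_mul_div_right _ _ two_pos]

theorem qTerm_succ (a b q u : ℝ) (n : ℕ) :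
    qTerm a b q u (n + 1) =
      qTerm a b q u n * (b / u * q ^ (n + 1) / ((1 - q * q ^ n) * (1 - -a * q / u * q ^ n))) := by
  rw [qTerm, qTerm, qProd_succ, qProd_succ, succ_mul_add_two_div_two, div_mul_div_comm]
  congr 1 <;> ring

theorem qTerm_ne_zero {a b q u : ℝ} (hb : b ≠ 0) (h0 : 0 < q) (h1 : q < 1) (hu : u ≠ 0)
    (h : ∀ k, 1 - -a * q / u * q ^ k ≠ 0) (n : ℕ) : qTerm a b q u n ≠ 0 := by
  have := qProd_ne_zero (fun k => (one_sub_mul_pow_pos h0 h1 k).ne') n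
  have := qProd_ne_zero h n
  unfold qTerm
  positivity

theorem qTerm_pos {a b q u : ℝ} (hb : 0 < b) (h0 : 0 < q) (h1 : q < 1) (hu : 0 < u)
    (h : ∀ k, 0 < 1 - -a * q / u * q ^ k) (n : ℕ) : 0 < qTerm a b q u n := by
  have := qProd_pos (fun k => one_sub_mul_pow_pos h0 h1 k) n
  have := qProd_pos h n
  unfold qTerm
  positivity

theorem summable_qTerm {a b q u : ℝ} (hb : b ≠ 0) (h0 : 0 < q) (h1 : q < 1) (hu : u ≠ 0)
    (h : ∀ k, 1 - -a * q / u * q ^ k ≠ 0) : Summable (qTerm a b q u) := by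
  have hne := qTerm_ne_zero hb h0 h1 hu h
  refine summable_of_ratio_test_tendsto_lt_one zero_lt_one (.of_forall hne) ?_
  have hq := tendsto_pow_atTop_nhds_zero_of_lt_one h0.le h1
  have hlim : Tendsto (fun n : ℕ => b / u * q ^ (n + 1) /
      ((1 - q * q ^ n) * (1 - -a * q / u * q ^ n))) atTop
      (𝓝 (b / u * 0 / ((1 - q * 0) * (1 - -a * q / u * 0)))) :=
    ((hq.comp (tendsto_add_atTop_nat 1)).const_mul _).div
      (((hq.const_mul _).const_sub _).mul ((hq.const_mul _).const_sub _)) (by simp)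
  have := hlim.norm
  simp only [mul_zero, zero_div, norm_zero] at this
  refine this.congr fun n => ?_
  rw [qTerm_succ, norm_mul, mul_div_cancel_left₀ _ (norm_ne_zero_iff.2 (hne n))]

/-- Replacing `u` by `uq` or `u/q` changes the second q-product by boundary factors only. Once these
are extracted, a rational identity in `u`, `q`, `q^n` remains. -/
theorem qTerm_contiguous {a b q u : ℝ} (h0 : 0 < q) (h1 : q < 1) (hu : u ≠ 0)
    (h : ∀ k, 1 - -a / u * q ^ k ≠ 0) (n : ℕ) :
    (u + a) * (qTerm a b q (u * q) (n + 1) - qTerm a b q u (n + 1)) =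
      b * qTerm a b q u n - a * b / (u / q + a) * qTerm a b q (u / q) n := by
  have hq := h0.ne'
  have hP := qProd_ne_zero (fun k => (one_sub_mul_pow_pos h0 h1 k).ne') n
  have h' : ∀ k, 1 - -a * q / u * q ^ k ≠ 0 := fun k => by
    convert h (k + 1) using 2; ring
  have hlast := h' n
  have hfirst := h 0
  have hsecond := h' 0
  have hpow := (one_sub_mul_pow_pos h0 h1 n).ne'
  have hQ := qProd_ne_zero h' n
  have e1 : -a * q / (u * q) = -a / u := by field_simp
  have e2 : -a * q / (u / q) = -a * q / u * q := by field_simp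
  have e3 : -a / u * q = -a * q / u := by ring
  have hshift : qProd (-a * q / u) q n * (1 - -a * q / u * q ^ n) =
      (1 - -a * q / u) * qProd (-a * q / u * q) q n := by rw [← qProd_succ, qProd_succ']
  have hR' : qProd (-a * q / u * q) q n =
      qProd (-a * q / u) q n * (1 - -a * q / u * q ^ n) / (1 - -a * q / u) := by
    rw [hshift, mul_div_cancel_left₀]; simpa using hsecond
  simp only [qTerm]
  rw [e1, e2, qProd_succ' (-a / u), e3, qProd_succ, qProd_succ, succ_mul_add_two_div_two, hR']
  generalize qProd (-a * q / u) q n = Q at *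
  generalize qProd q q n = P at *
  have k1 : u + a ≠ 0 := by
    intro h; apply hfirst; field_simp; linarith
  have k2 : u + a * q ≠ 0 := by
    intro h; apply hsecond; field_simp; linarith
  have k3 : u + a * q * q ^ n ≠ 0 := by
    intro h; apply hlast; field_simp; linarith
  have f1 : 1 - -a / u = (u + a) / u := by field_simp; ring
  have f2 : 1 - -a * q / u = (u + a * q) / u := by field_simp; ring
  have f3 : 1 - -a * q / u * q ^ n = (u + a * q * q ^ n) / u := by field_simp; ring
  have f4 : u / q + a = (u + a * q) / q := by field_simp
  rw [f1, f2, f3, f4]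
  simp only [div_pow, mul_pow, pow_add, pow_succ]
  generalize q ^ (n * (n + 1) / 2) = T at *
  have hqn : q ^ n ≠ 0 := by positivity
  generalize q ^ n = t at *
  have hpow' : 1 - t * q ≠ 0 := by rwa [mul_comm]
  have k3' : u + a * t * q ≠ 0 := by rwa [mul_right_comm]
  field_simp
  ring

theorem tsum_qTerm_contiguous {a b q u : ℝ} (hb : b ≠ 0) (h0 : 0 < q) (h1 : q < 1) (hu : u ≠ 0)
    (h : ∀ k, 1 - -a / u * q ^ k ≠ 0) :
    (u + a) * ∑' n, qTerm a b q (u * q) n =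
      (a + b + u) * ∑' n, qTerm a b q u n -
        a * b / (u / q + a) * ∑' n, qTerm a b q (u / q) n := by
  have hq := h0.ne'
  have s0 : Summable (qTerm a b q (u * q)) := summable_qTerm hb h0 h1 (by positivity) fun k => by
    convert h k using 3; field_simp
  have s1 : Summable (qTerm a b q u) := summable_qTerm hb h0 h1 hu fun k => by
    convert h (k + 1) using 2; ring
  have s2 : Summable (qTerm a b q (u / q)) := summable_qTerm hb h0 h1 (by positivity) fun k => by
    convert h (k + 2) using 2; field_simp; ring
  have key : (u + a) * (∑' n, qTerm a b q (u * q) (n + 1) - ∑' n, qTerm a b q u (n + 1)) =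
      b * ∑' n, qTerm a b q u n - a * b / (u / q + a) * ∑' n, qTerm a b q (u / q) n := by
    rw [← ((summable_nat_add_iff 1).2 s0).tsum_sub ((summable_nat_add_iff 1).2 s1),
      ← tsum_mul_left, ← tsum_mul_left, ← tsum_mul_left,
      ← (s1.mul_left b).tsum_sub (s2.mul_left _)]
    exact tsum_congr fun n => qTerm_contiguous h0 h1 hu h n
  have z0 := s0.tsum_eq_zero_add
  have z1 := s1.tsum_eq_zero_add
  rw [qTerm_zero] at z0 z1
  linear_combination key + (u + a) * z0 - (u + a) * z1

/-! ### Positive solutions of three-term recurrences -/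

/-- A continued fraction with coefficients at least `1` whose three-term recurrence has a positive
solution `Y` converges to `Y 1 / Y 0`. -/
theorem tendsto_convs_infiniteCF {s Y : ℕ → ℝ} (hs : ∀ n, 1 ≤ s n) (hY : ∀ n, 0 < Y n)
    (hrec : ∀ n, Y n = s n * Y (n + 1) + Y (n + 2)) :
    Tendsto (infiniteCF 0 s).convs atTop (𝓝 (Y 1 / Y 0)) := by
  have hget : ∀ n, (infiniteCF 0 s).s.get? n = some ⟨1, s n⟩ := fun n => rfl
  have hnum1 : (infiniteCF 0 s).nums 1 = 1 := by
    rw [GenContFract.first_num_eq (hget 0)]; simp [infiniteCF]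
  have hden1 : (infiniteCF 0 s).dens 1 = s 0 := by
    rw [GenContFract.first_den_eq (hget 0)]
  have hnum0 : (infiniteCF 0 s).nums 0 = 0 := by
    rw [GenContFract.zeroth_num_eq_h]; rfl
  have hden0 : (infiniteCF 0 s).dens 0 = 1 := GenContFract.zeroth_den_eq_one
  have hnum : ∀ n, (infiniteCF 0 s).nums (n + 2) =
      s (n + 1) * (infiniteCF 0 s).nums (n + 1) + (infiniteCF 0 s).nums n := fun n => by
    rw [GenContFract.nums_recurrence (hget (n + 1)) rfl rfl, one_mul]
  have hden : ∀ n, (infiniteCF 0 s).dens (n + 2) =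
      s (n + 1) * (infiniteCF 0 s).dens (n + 1) + (infiniteCF 0 s).dens n := fun n => by
    rw [GenContFract.dens_recurrence (hget (n + 1)) rfl rfl, one_mul]
  have hpos : ∀ n, 1 ≤ (infiniteCF 0 s).dens n ∧ 1 ≤ (infiniteCF 0 s).dens (n + 1) := by
    intro n
    induction n with
    | zero => exact ⟨hden0.ge, hden1 ▸ hs 0⟩
    | succ n ih =>
      refine ⟨ih.2, ?_⟩
      rw [hden]
      nlinarith [ih.1, ih.2, hs (n + 1)]
  -- Both sides solve the same recurrence up to sign, so two consecutive indices are carried through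
  -- the induction.
  have herr : ∀ n,
      (infiniteCF 0 s).nums n * Y 0 - (infiniteCF 0 s).dens n * Y 1 = (-1) ^ (n + 1) * Y (n + 1) ∧
      (infiniteCF 0 s).nums (n + 1) * Y 0 - (infiniteCF 0 s).dens (n + 1) * Y 1 =
        (-1) ^ (n + 2) * Y (n + 2) := by
    intro n
    induction n with
    | zero => rw [hnum0, hden0, hnum1, hden1]; refine ⟨by norm_num, ?_⟩; norm_num; linarith [hrec 0]
    | succ n ih =>
      refine ⟨ih.2, ?_⟩
      rw [hnum, hden]
      linear_combination s (n + 1) * ih.2 + ih.1 + (-1) ^ (n + 1) * hrec (n + 1)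
  have hanti : Antitone Y := antitone_nat_of_succ_le fun n => by
    nlinarith [hrec n, hs n, hY (n + 1), hY (n + 2)]
  have hYlim : Tendsto Y atTop (𝓝 0) := by
    have hL := tendsto_atTop_ciInf hanti ⟨0, by rintro _ ⟨n, rfl⟩; exact (hY n).le⟩
    set L := ⨅ n, Y n
    have h1 : 0 ≤ L := ge_of_tendsto' hL fun n => (hY n).le
    -- Limit of `Y (n+1) + Y (n+2) ≤ Y n`.
    have h2 : L + L ≤ L :=
      le_of_tendsto_of_tendsto' ((hL.comp (tendsto_add_atTop_nat 1)).add
        (hL.comp (tendsto_add_atTop_nat 2))) hL fun n => by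
          simp only [Function.comp]
          nlinarith [hrec n, hs n, hY (n + 1)]
    rwa [show L = 0 by linarith] at hL
  refine tendsto_iff_norm_sub_tendsto_zero.2 ?_
  have hYlim' : Tendsto (fun n => Y (n + 1) / Y 0) atTop (𝓝 0) := by
    simpa using (hYlim.comp (tendsto_add_atTop_nat 1)).div_const (Y 0)
  refine squeeze_zero (fun _ => norm_nonneg _) (fun n => ?_) hYlim'
  have hd : 0 < (infiniteCF 0 s).dens n := by linarith [(hpos n).1]
  have hY0 := hY 0
  rw [GenContFract.conv_eq_num_div_den, div_sub_div _ _ hd.ne' hY0.ne', (herr n).1, norm_div,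
    norm_mul, norm_mul, norm_pow, norm_neg, norm_one, one_pow, one_mul, Real.norm_of_nonneg hd.le,
    Real.norm_of_nonneg hY0.le, Real.norm_of_nonneg (hY _).le]
  apply div_le_div_of_nonneg_left (hY _).le hY0
  nlinarith [(hpos n).1]

theorem forall_pos_of_eventually_pos {X β : ℕ → ℝ} {κ : ℝ} (hκ : 0 < κ) (hβ : ∀ n, 0 < β n)
    (hrec : ∀ n, X n = β n * X (n + 1) + κ * X (n + 2)) {J : ℕ} (hJ : ∀ n, J ≤ n → 0 < X n) :
    ∀ n, 0 < X n := by
  induction J with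
  | zero => exact fun n => hJ n n.zero_le
  | succ J ih =>
    refine ih fun n hn => ?_
    rcases hn.eq_or_lt with rfl | h
    · rw [hrec]
      have := hβ J
      have := hJ (J + 1) le_rfl
      have := hJ (J + 2) (by omega)
      positivity
    · exact hJ n h

/-! ### The q-series solution and its sign -/

/-- The solution of `X_j = (a + b + d M^{j+1}) X_{j+1} - a b X_{j+2}` given by `q`-series,
where `q = 1/M`. -/
noncomputable def qSol (a b d M : ℝ) (j : ℕ) : ℝ :=
  (∑' n, qTerm a b M⁻¹ (d * M ^ j) n) / ∏ i ∈ Finset.range j, (d * M ^ (i + 1) + a)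

/-- The factor equals `(d M^(j+k+1) + a) / (d M^(j+k+1))`, so one nonvanishing family controls all
the q-products. -/
theorem one_sub_ne_zero_of_shift {a d M : ℝ} (hd : 0 < d) (hM : 1 < M)
    (hne : ∀ j : ℕ, d * M ^ (j + 1) + a ≠ 0) (j k : ℕ) :
    1 - -a / (d * M ^ (j + 1)) * M⁻¹ ^ k ≠ 0 := by
  have hM0 : 0 < M := by linarith
  have : 1 - -a / (d * M ^ (j + 1)) * M⁻¹ ^ k =
      (d * M ^ (j + k + 1) + a) / (d * M ^ (j + k + 1)) := by
    rw [inv_pow]; field_simp; ring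
  rw [this]
  exact div_ne_zero (hne _) (by positivity)

theorem qSol_rec {a b d M : ℝ} (hb : b ≠ 0) (hd : 0 < d) (hM : 1 < M)
    (hne : ∀ j : ℕ, d * M ^ (j + 1) + a ≠ 0) (j : ℕ) :
    qSol a b d M j =
      (a + b + d * M ^ (j + 1)) * qSol a b d M (j + 1) + -(a * b) * qSol a b d M (j + 2) := by
  have hM0 : 0 < M := by linarith
  have key := tsum_qTerm_contiguous (u := d * M ^ (j + 1)) hb (inv_pos.2 hM0)
    (inv_lt_one_of_one_lt₀ hM) (by positivity) (one_sub_ne_zero_of_shift hd hM hne j)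
  have e1 : d * M ^ (j + 1) * M⁻¹ = d * M ^ j := by field_simp; ring
  have e2 : d * M ^ (j + 1) / M⁻¹ = d * M ^ (j + 2) := by field_simp; ring
  rw [e1, e2] at key
  have hP : ∏ i ∈ Finset.range j, (d * M ^ (i + 1) + a) ≠ 0 :=
    Finset.prod_ne_zero_iff.2 fun i _ => hne i
  have n1 := hne j
  have n2 := hne (j + 1)
  rw [add_assoc j 1 1] at n2
  norm_num at n2
  simp only [qSol, Finset.prod_range_succ]
  rw [add_assoc j 1 1]
  norm_num
  generalize ∑' n, qTerm a b M⁻¹ (d * M ^ j) n = G0 at *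
  generalize ∑' n, qTerm a b M⁻¹ (d * M ^ (j + 1)) n = G1 at *
  generalize ∑' n, qTerm a b M⁻¹ (d * M ^ (j + 2)) n = G2 at *
  generalize ∏ i ∈ Finset.range j, (d * M ^ (i + 1) + a) = P at *
  have hG0 : G0 = ((a + b + d * M ^ (j + 1)) * G1 - a * b / (d * M ^ (j + 2) + a) * G2) /
      (d * M ^ (j + 1) + a) := by rw [eq_div_iff n1, ← key, mul_comm]
  rw [hG0]
  generalize d * M ^ (j + 1) = v1 at *
  generalize d * M ^ (j + 2) = v2 at *
  field_simp
  ring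

theorem exists_qSol_sign {a b d M : ℝ} (hb : 0 < b) (hd : 0 < d) (hM : 1 < M)
    (hne : ∀ j : ℕ, d * M ^ (j + 1) + a ≠ 0) :
    ∃ (p : ℝ) (J : ℕ), ∀ j, J ≤ j → 0 < p * qSol a b d M j := by
  have hM0 : 0 < M := by linarith
  obtain ⟨J, hJ⟩ := pow_unbounded_of_one_lt (-a / d) hM
  have hpos : ∀ j, J ≤ j → 0 < d * M ^ j + a := fun j hj => by
    have := pow_le_pow_right₀ hM.le hj
    rw [div_lt_iff₀ hd] at hJ
    nlinarith
  -- Beyond `J` the series and the new factors are positive, so only the first `J` factors decide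
  -- the sign.
  refine ⟨∏ i ∈ Finset.range J, (d * M ^ (i + 1) + a), J,
    fun j hj => ?_⟩
  have hsign : 0 < (∏ i ∈ Finset.range J, (d * M ^ (i + 1) + a)) *
      ∏ i ∈ Finset.range j, (d * M ^ (i + 1) + a) := by
    rw [← Finset.prod_range_mul_prod_Ico _ hj, ← mul_assoc]
    refine mul_pos (mul_self_pos.2 (Finset.prod_ne_zero_iff.2 fun i _ => hne i)) ?_
    refine Finset.prod_pos fun i hi => hpos _ ?_
    have := (Finset.mem_Ico.1 hi).1
    omega
  have hfac : ∀ k, 0 < 1 - -a * M⁻¹ / (d * M ^ j) * M⁻¹ ^ k := fun k => by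
    have : 1 - -a * M⁻¹ / (d * M ^ j) * M⁻¹ ^ k =
        (d * M ^ (j + k + 1) + a) / (d * M ^ (j + k + 1)) := by
      rw [inv_pow]; field_simp; ring
    rw [this]
    exact div_pos (hpos _ (by omega)) (by positivity)
  have hq0 := inv_pos.2 hM0
  have hq1 := inv_lt_one_of_one_lt₀ hM
  have hu : 0 < d * M ^ j := by positivity
  have hG : 0 < ∑' n, qTerm a b M⁻¹ (d * M ^ j) n :=
    (summable_qTerm hb.ne' hq0 hq1 hu.ne' fun k => (hfac k).ne').tsum_pos
      (fun n => (qTerm_pos hb hq0 hq1 hu hfac n).le) 0 (qTerm_pos hb hq0 hq1 hu hfac 0)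
  have hPj := right_ne_zero_of_mul hsign.ne'
  have : (∏ i ∈ Finset.range J, (d * M ^ (i + 1) + a)) * qSol a b d M j =
      ((∏ i ∈ Finset.range J, (d * M ^ (i + 1) + a)) *
        ∏ i ∈ Finset.range j, (d * M ^ (i + 1) + a)) * (∑' n, qTerm a b M⁻¹ (d * M ^ j) n) /
        (∏ i ∈ Finset.range j, (d * M ^ (i + 1) + a)) ^ 2 := by
    rw [qSol]; field_simp
  rw [this]
  positivity

/-- Integrality excludes zeros of `d m^j + a`, where `x = -a` solves `x (x + e) = e / c`. -/
theorem pow_add_root_ne_zero {c e d M a : ℝ} (hM : 2 ≤ M) (hd : 0 < d) (hec : 0 < e / c)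
    (he : 1 ≤ e ∨ e ≤ -1) (ha : a * (a - e) = e / c) (hk : 1 ≤ d * M / (e / c))
    (hc1 : 1 ≤ c + d * M / (e / c)) (he1 : 1 ≤ e + d * M ^ 2) (j : ℕ) :
    d * M ^ (j + 1) + a ≠ 0 := by
  intro h
  have hκ : e / c ≤ d * M := by rwa [le_div_iff₀ hec, one_mul] at hk
  have hx : a = -(d * M ^ (j + 1)) := by linarith
  have hdM : 0 < d * M := by positivity
  rcases j with _ | j
  · rw [zero_add, pow_one] at hx
    rw [hx] at ha
    have ha' : d * M * (d * M + e) = e / c := by linarith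
    rcases he with he | he
    -- Here `dM (dM + e) = e/c ≤ dM` would force `dM + e ≤ 1`.
    · nlinarith
    · have hc0 : c ≠ 0 := by rintro rfl; simp at hec
      have he0 : e ≠ 0 := by linarith
      have hc : c = e / (d * M * (d * M + e)) := by rw [ha']; field_simp
      have hpos : 0 < d * M + e := by
        by_contra hcon
        nlinarith
      -- The first partial quotient would be `1/(dM)`, yet it is at least `1` while `dM > -e ≥ 1`.
      have : c + d * M / (e / c) = 1 / (d * M) := by
        rw [← ha', hc]; field_simp
        ring
      rw [this, le_div_iff₀ hdM] at hc1
      linarith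
  · have hp : 1 ≤ M ^ j := one_le_pow₀ (by linarith)
    have hge : d * M ^ 2 ≤ d * M ^ (j + 1 + 1) := by
      rw [show d * M ^ (j + 1 + 1) = d * M ^ 2 * M ^ j by ring]
      exact le_mul_of_one_le_right (by positivity) hp
    have hlt : d * M < d * M ^ 2 := by nlinarith
    rw [hx] at ha
    -- With `x = d M^(j+2)`, `x + e ≥ 1` gives `x (x + e) ≥ x > dM ≥ e/c`.
    nlinarith

/-! ### The continued fraction -/

theorem theorem2 (c e m : ℤ) (d : ℚ) (hm : 1 < m)
    (hdm : ∃ k : ℕ, 0 < k ∧ d * (m : ℚ) ^ 2 = (k : ℚ))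
    (hdcm : ∃ k : ℕ, 0 < k ∧ d * (c : ℚ) * (m : ℚ) / (e : ℚ) = (k : ℚ))
    (hc : 0 < (c : ℚ) + d * (c : ℚ) * (m : ℚ) / (e : ℚ))
    (he : 0 < (e : ℚ) + d * (m : ℚ) ^ 2)
    (a b : ℝ)
    (ha : a = ((e : ℝ) - Real.sqrt ((e : ℝ) ^ 2 + 4 * (e : ℝ) / (c : ℝ))) / 2)
    (hb : b = ((e : ℝ) + Real.sqrt ((e : ℝ) ^ 2 + 4 * (e : ℝ) / (c : ℝ))) / 2)
    (N D : ℕ → ℝ)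
    (hN : ∀ n : ℕ, N n = ((b / (d : ℝ)) ^ n * ((m : ℝ) ^ (n * (n + 3) / 2))⁻¹) /
      (qProd (1 / (m : ℝ)) (1 / (m : ℝ)) n *
        qProd (-a / ((d : ℝ) * (m : ℝ) ^ 2)) (1 / (m : ℝ)) n))
    (hD : ∀ n : ℕ, D n = ((b / (d : ℝ)) ^ n * ((m : ℝ) ^ (n * (n + 1) / 2))⁻¹) /
      (qProd (1 / (m : ℝ)) (1 / (m : ℝ)) n *
        qProd (-a / ((d : ℝ) * (m : ℝ))) (1 / (m : ℝ)) n)) :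
    -- every expression on the right-hand side is well defined
    ((m : ℝ) * (d : ℝ) + a ≠ 0 ∧
      (∀ n : ℕ, qProd (1 / (m : ℝ)) (1 / (m : ℝ)) n ≠ 0 ∧
        qProd (-a / ((d : ℝ) * (m : ℝ) ^ 2)) (1 / (m : ℝ)) n ≠ 0 ∧
        qProd (-a / ((d : ℝ) * (m : ℝ))) (1 / (m : ℝ)) n ≠ 0) ∧
      Summable N ∧ Summable D ∧ ∑' n, D n ≠ 0) ∧
    -- the continued fraction converges to the right-hand side
    Tendsto
      (infiniteCF 0 (interlace
        (fun n => (c : ℝ) + (d : ℝ) * (c : ℝ) / (e : ℝ) * (m : ℝ) ^ (2 * n - 1))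
        (fun n => (e : ℝ) + (d : ℝ) * (m : ℝ) ^ (2 * n)))).convs
      atTop
      (𝓝 (((e : ℝ) / (c : ℝ)) / ((m : ℝ) * (d : ℝ) + a) *
        ((∑' n, N n) / (∑' n, D n)))) := by
  obtain ⟨k₁, hk₁, hk₁'⟩ := hdm
  obtain ⟨k₂, hk₂, hk₂'⟩ := hdcm
  have hM : (2 : ℝ) ≤ m := by exact_mod_cast hm
  have hM0 : (0 : ℝ) < m := by linarith
  have hM1 : (1 : ℝ) < m := by linarith
  have r1 : (d : ℝ) * (m : ℝ) ^ 2 = k₁ := by exact_mod_cast congrArg (Rat.cast : ℚ → ℝ) hk₁'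
  have r2 : (d : ℝ) * (c : ℝ) * (m : ℝ) / (e : ℝ) = k₂ := by
    exact_mod_cast congrArg (Rat.cast : ℚ → ℝ) hk₂'
  have hc1 : (1 : ℝ) ≤ c + k₂ := by
    rw [hk₂'] at hc
    have : 0 < c + (k₂ : ℤ) := by exact_mod_cast hc
    exact_mod_cast this
  have he1 : (1 : ℝ) ≤ e + k₁ := by
    rw [hk₁'] at he
    have : 0 < e + (k₁ : ℤ) := by exact_mod_cast he
    exact_mod_cast this
  have p1 : (1 : ℝ) ≤ k₁ := by exact_mod_cast hk₁
  have p2 : (1 : ℝ) ≤ k₂ := by exact_mod_cast hk₂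
  have heZ : e ≠ 0 := by rintro rfl; simp at r2; linarith
  have hcZ : c ≠ 0 := by rintro rfl; simp at r2; linarith
  have he0 : (e : ℝ) ≠ 0 := by exact_mod_cast heZ
  have hc0 : (c : ℝ) ≠ 0 := by exact_mod_cast hcZ
  have heabs : (1 : ℝ) ≤ e ∨ (e : ℝ) ≤ -1 := by
    rcases lt_or_gt_of_ne heZ with h | h
    · right; exact_mod_cast (by omega : e ≤ -1)
    · left; exact_mod_cast h
  have hM2 : (0 : ℝ) < (m : ℝ) ^ 2 := by positivity
  have hd : (0 : ℝ) < d := by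
    by_contra h
    nlinarith
  have r3 : (d : ℝ) * m / ((e : ℝ) / c) = k₂ := by rw [← r2]; field_simp
  have hκ : (0 : ℝ) < (e : ℝ) / c := by
    by_contra h
    have : (d : ℝ) * m / ((e : ℝ) / c) ≤ 0 :=
      div_nonpos_of_nonneg_of_nonpos (by positivity) (not_lt.1 h)
    linarith
  have hdisc : (0 : ℝ) ≤ (e : ℝ) ^ 2 + 4 * (e : ℝ) / c := by
    rw [mul_div_assoc]; positivity
  have hsq := Real.sq_sqrt hdisc
  have hsqrt : |(e : ℝ)| < √((e : ℝ) ^ 2 + 4 * (e : ℝ) / c) := by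
    apply Real.lt_sqrt_of_sq_lt
    rw [sq_abs, mul_div_assoc]; linarith
  rw [mul_div_assoc] at ha hb hsq hsqrt
  generalize √((e : ℝ) ^ 2 + 4 * ((e : ℝ) / c)) = S at *
  have hab : a + b = e := by rw [ha, hb]; ring
  have hmul : -(a * b) = (e : ℝ) / c := by rw [ha, hb]; linear_combination hsq / 4
  have hb0 : 0 < b := by rw [hb]; linarith [neg_abs_le (e : ℝ)]
  have hne : ∀ j : ℕ, (d : ℝ) * (m : ℝ) ^ (j + 1) + a ≠ 0 :=
    pow_add_root_ne_zero (c := c) (e := e) hM hd hκ heabs (by rw [← hmul, ← hab]; ring)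
      (r3 ▸ p2) (r3 ▸ hc1) (r1 ▸ he1)
  have hshift := one_sub_ne_zero_of_shift hd hM1 hne
  have hq0 : 0 < (m : ℝ)⁻¹ := inv_pos.2 hM0
  have hq1 : (m : ℝ)⁻¹ < 1 := inv_lt_one_of_one_lt₀ hM1
  have z0 : -a / ((d : ℝ) * m) = -a * (m : ℝ)⁻¹ / (d * (m : ℝ) ^ 0) := by field_simp
  have z1 : -a / ((d : ℝ) * (m : ℝ) ^ 2) = -a * (m : ℝ)⁻¹ / (d * (m : ℝ) ^ 1) := by field_simp
  have f0 : ∀ k, 1 - -a * (m : ℝ)⁻¹ / (d * (m : ℝ) ^ 0) * (m : ℝ)⁻¹ ^ k ≠ 0 := fun k => by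
    rw [← z0]; simpa using hshift 0 k
  have f1 : ∀ k, 1 - -a * (m : ℝ)⁻¹ / (d * (m : ℝ) ^ 1) * (m : ℝ)⁻¹ ^ k ≠ 0 := fun k => by
    rw [← z1]; exact hshift 1 k
  have hDeq : D = qTerm a b (m : ℝ)⁻¹ (d * (m : ℝ) ^ 0) := by
    funext n
    rw [hD, qTerm, z0, one_div, inv_pow, pow_zero, mul_one]
  have hNeq : N = qTerm a b (m : ℝ)⁻¹ (d * (m : ℝ) ^ 1) := by
    funext n
    -- The extra `m^(-n)` turns `(b/d)^n` into `(b/(dm))^n`.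
    have hn : n * (n + 3) / 2 = n * (n + 1) / 2 + n := by
      rw [show n * (n + 3) = n * (n + 1) + n * 2 by ring, Nat.add_mul_div_right _ _ two_pos]
    rw [hN, qTerm, z1, one_div, hn]
    congr 1
    rw [pow_one, pow_add, mul_inv, inv_pow, ← div_div, div_pow (b / (d : ℝ))]
    ring
  have hsN : Summable N := hNeq ▸ summable_qTerm hb0.ne' hq0 hq1 (by positivity) f1
  have hsD : Summable D := hDeq ▸ summable_qTerm hb0.ne' hq0 hq1 (by positivity) f0
  have hX0 : qSol a b d m 0 = ∑' n, D n := by rw [hDeq]; simp [qSol]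
  have hX1 : qSol a b d m 1 = (∑' n, N n) / (m * d + a) := by
    rw [hNeq]; simp [qSol, mul_comm]
  obtain ⟨p, J, hJ⟩ := exists_qSol_sign hb0 hd hM1 hne
  have hrec := qSol_rec hb0.ne' hd hM1 hne
  rw [hab, hmul] at hrec
  set κ : ℝ := (e : ℝ) / c with hκdef
  have hmono : ∀ j : ℕ, (m : ℝ) ≤ (m : ℝ) ^ (j + 1) := fun j => le_self_pow₀ hM1.le j.succ_ne_zero
  have hs0 : (1 : ℝ) ≤ (e + d * m) / κ := by
    have : ((e : ℝ) + d * m) / κ = c + k₂ := by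
      rw [add_div, r3, hκdef]; congr 1; field_simp
    rwa [this]
  have hβ0 : κ ≤ e + d * m := by rwa [le_div_iff₀ hκ, one_mul] at hs0
  have hβκ : ∀ j : ℕ, κ ≤ e + d * (m : ℝ) ^ (j + 1) := fun j =>
    hβ0.trans (by gcongr; exact hmono j)
  have hβ1 : ∀ j : ℕ, (1 : ℝ) ≤ e + d * (m : ℝ) ^ (j + 2) := fun j => by
    have : (m : ℝ) ^ 2 ≤ (m : ℝ) ^ (j + 2) := pow_le_pow_right₀ hM1.le (by omega)
    nlinarith
  have hXpos : ∀ n, 0 < p * qSol a b d m n :=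
    forall_pos_of_eventually_pos (β := fun j => e + d * (m : ℝ) ^ (j + 1)) hκ
      (fun j => hκ.trans_le (hβκ j)) (fun j => by linear_combination p * hrec j) hJ
  have hp : p ≠ 0 := left_ne_zero_of_mul (hXpos 0).ne'
  have hX0ne : qSol a b d m 0 ≠ 0 := right_ne_zero_of_mul (hXpos 0).ne'
  have hmda : (m : ℝ) * d + a ≠ 0 := by simpa [mul_comm] using hne 0
  refine ⟨⟨hmda, fun n => ⟨?_, ?_, ?_⟩, hsN, hsD, hX0 ▸ hX0ne⟩, ?_⟩
  · rw [one_div]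
    exact qProd_ne_zero (fun k => (one_sub_mul_pow_pos hq0 hq1 k).ne') n
  · rw [one_div, z1]; exact qProd_ne_zero f1 n
  · rw [one_div, z0]; exact qProd_ne_zero f0 n
  · have hlim : κ / (m * d + a) * ((∑' n, N n) / ∑' n, D n) =
        κ ^ ((1 + 1) / 2) * (p * qSol a b d m 1) / (κ ^ ((0 + 1) / 2) * (p * qSol a b d m 0)) := by
      rw [hX0] at hX0ne
      rw [hX0, hX1]
      norm_num
      field_simp
    rw [hlim]
    -- The exponent rises by one from even to odd `n`, which divides the even-indexed coefficients
    -- by `κ` and makes every partial numerator `1`.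
    refine tendsto_convs_infiniteCF (Y := fun n => κ ^ ((n + 1) / 2) * (p * qSol a b d m n))
      (fun n => ?_) (fun n => mul_pos (by positivity) (hXpos n)) (fun n => ?_)
    all_goals
      rcases Nat.even_or_odd' n with ⟨i, rfl | rfl⟩
    · have h1 : 2 * (i + 1) - 1 = 2 * i + 1 := by omega
      simp only [interlace, even_two_mul, if_true, Nat.mul_div_cancel_left i two_pos, h1]
      have := hβκ (2 * i)
      rw [← one_le_div hκ] at this
      refine this.trans_eq ?_
      rw [hκdef]; field_simp
    · have h1 : (2 * i + 1) / 2 + 1 = i + 1 := by omega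
      simp only [interlace, Nat.not_even_bit1, if_false, h1]
      exact hβ1 (2 * i)
    · have h1 : 2 * (i + 1) - 1 = 2 * i + 1 := by omega
      have h2 : (2 * i + 1) / 2 = i := by omega
      have h3 : (2 * i + 1 + 1) / 2 = i + 1 := by omega
      have h4 : (2 * i + 2 + 1) / 2 = i + 1 := by omega
      simp only [interlace, even_two_mul, if_true, Nat.mul_div_cancel_left i two_pos, h1, h2, h3,
        h4]
      have hs : (c : ℝ) + d * c / e * (m : ℝ) ^ (2 * i + 1) =
          (e + d * (m : ℝ) ^ (2 * i + 1)) / κ := by rw [hκdef]; field_simp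
      rw [hs, hrec (2 * i), pow_succ κ]
      field_simp
    · have h1 : (2 * i + 1) / 2 + 1 = i + 1 := by omega
      have h2 : (2 * i + 1 + 1) / 2 = i + 1 := by omega
      have h3 : (2 * i + 1 + 1 + 1) / 2 = i + 1 := by omega
      have h4 : (2 * i + 1 + 2 + 1) / 2 = i + 2 := by omega
      simp only [interlace, Nat.not_even_bit1, if_false, h1, h2, h3, h4]
      rw [hrec (2 * i + 1)]
      ring
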